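/- Let $\alpha\in[0,1)$ and let $\sigma_t,k_t$ be functions of time that are positive and continuous for $t>0$ and such that 1. $t\,\sigma_t^2\to 0$ as $t\to0^+$; 2. $t\,\sigma_t^{2\alpha}/k_t^{1-\alpha}$ tends to $0$ as $t\to 0^+$ and is non-decreasing on $(0,\infty)$; 3. $\sigma_t^2k_t$ is non-decreasing on $(0,\infty)$. For $t>0$ set $$\mathcal V_t(x)=\frac{t\,\sigma_t^{2\alpha}}{\Gamma(1-\alpha)}\Big(\frac{1-\alpha}{k_t}\Big)^{1-\alpha}\frac{e^{-(1-\alpha)x/(\sigma_t^2k_t)}}{x^{1+\alpha}}\mathbf 1_{x>0},\qquad \Gamma_t=\int_0^1x\,\mathcal V_t(x)\,dx,$$ and $\mathcal V_0=0$, $\Gamma_0=0$. An additive process is a real-valued càdlàg process $\{X_t\}_{t\ge0}$ with $X_0=0$ a.s. that has independent increments and is continuous in probability; an additive subordinator is an additive process whose paths are a.s. non-decreasing. Generating triplets are taken with respect to the truncation function $x\mathbf 1_{|x|\le1}$. An additive tempered stable subordinator (TSS) with parameters $\alpha,\sigma,k$ is an additive process $\{Z_t\}$ such that, for every $t\ge0$,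 the law of $Z_t$ has the generating triplet $(0,\mathcal V_t(x)dx,\Gamma_t)$, i.e. $\mathcal V_t(x)dx$ is a Lévy measure and $$\mathbb E[e^{iuZ_t}]=\exp\Big(iu\Gamma_t+\int_{\mathbb R}\big(e^{iux}-1-iux\mathbf 1_{|x|\le1}\big)\mathcal V_t(x)\,dx\Big)\qquad(u\in\mathbb R).$$ **Proposition.** A TSS with parameters $\alpha,\sigma,k$ exists on some probability space. Every such TSS, on any probability space, is an additive subordinator. For every $t\ge 0$ its Lévy measure gives no mass to $(-\infty,0]$ and satisfies $\int_{\mathbb R}(|x|\wedge1)\,\mathcal V_t(x)\,dx<\infty$, and its drift vanishes: $$b_t:=\Gamma_t-\int_{0\le x\le1}x\,\mathcal V_t(x)\,dx=0,$$ so that $\mathbb E[e^{iuZ_t}]=\exp\big(\int_{x>0}(e^{iux}-1)\,\mathcal V_t(x)\,dx\big)$ for all $u\in\mathbb R$. -/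

import Mathlib

open MeasureTheory ProbabilityTheory Filter Topology
open scoped NNReal ENNReal

/-- A path on `[0, ∞)` is càdlàg: right-continuous with (finite) left limits. -/
def IsCadlagPath (f : ℝ≥0 → ℝ) : Prop :=
  (∀ t, ContinuousWithinAt f (Set.Ici t) t) ∧ ∀ t, 0 < t → ∃ l : ℝ, Tendsto f (𝓝[<] t) (𝓝 l)

/-- Real-valued additive processes: càdlàg, started at `0` almost surely, with independent
increments and continuous in probability. -/
structure IsAdditiveProcess {Ω : Type*} [MeasurableSpace Ω] (X : ℝ≥0 → Ω → ℝ)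
    (P : Measure Ω) : Prop where
  measurable : ∀ t, Measurable (X t)
  cadlag : ∀ ω, IsCadlagPath (fun t => X t ω)
  zero_ae : ∀ᵐ ω ∂P, X 0 ω = 0
  indepIncrements : HasIndepIncrements X P
  continuousInProbability : ∀ t, TendstoInMeasure P X (𝓝 t) (X t)

/-- An additive subordinator is an additive process with almost surely non-decreasing paths. -/
structure IsAdditiveSubordinator {Ω : Type*} [MeasurableSpace Ω] (X : ℝ≥0 → Ω → ℝ)
    (P : Measure Ω) : Prop where
  additive : IsAdditiveProcess X P
  monotone_ae : ∀ᵐ ω ∂P, Monotone (fun t => X t ω)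

/-- Lévy measures on `ℝ`: no mass at `0` and `∫ min (x², 1) ν(dx) < ∞`. -/
structure IsLevyMeasure (ν : Measure ℝ) : Prop where
  zero : ν {0} = 0
  lintegral_lt_top : ∫⁻ x, ENNReal.ofReal (min (x ^ 2) 1) ∂ν < ∞

/-- The law `μ` has generating triplet `(A, ν, γ)`, with respect to the truncation function
`x ↦ x 1_{|x| ≤ 1}` (Lévy–Khintchine formula). -/
structure HasGeneratingTriplet (μ : Measure ℝ) (A : ℝ) (ν : Measure ℝ) (γ : ℝ) : Prop where
  diffusion_nonneg : 0 ≤ A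
  levy : IsLevyMeasure ν
  charFun_eq : ∀ u : ℝ, charFun μ u =
    Complex.exp (-((A * u ^ 2 / 2 : ℝ) : ℂ) + Complex.I * (γ : ℂ) * (u : ℂ)
      + ∫ x, (Complex.exp (Complex.I * (u : ℂ) * (x : ℂ)) - 1
          - (Set.Icc (-1 : ℝ) 1).indicator (fun y => Complex.I * (u : ℂ) * (y : ℂ)) x) ∂ν)

/-- The drift `b = γ - ∫_{0 ≤ x ≤ 1} x ν(dx)` attached to a Lévy measure `ν` and a drift term `γ`
of a generating triplet. -/
noncomputable def subordinatorDrift (ν : Measure ℝ) (γ : ℝ) : ℝ :=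
  γ - ∫ x in Set.Icc (0 : ℝ) 1, x ∂ν

/-- The Lévy density `x ↦ 𝒱_t(x)` of the additive tempered stable subordinator. It vanishes
identically at time `t = 0`, because of its factor `t`. -/
noncomputable def tssDensity (α : ℝ) (σ k : ℝ≥0 → ℝ) (t : ℝ≥0) (x : ℝ) : ℝ :=
  (Set.Ioi (0 : ℝ)).indicator (fun y =>
    (t : ℝ) * (σ t) ^ (2 * α) / Real.Gamma (1 - α) * ((1 - α) / k t) ^ (1 - α)
      * (Real.exp (-(1 - α) * y / ((σ t) ^ 2 * k t)) / y ^ (1 + α))) x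

/-- The measure `𝒱_t(x) dx`. -/
noncomputable def tssLevyMeasure (α : ℝ) (σ k : ℝ≥0 → ℝ) (t : ℝ≥0) : Measure ℝ :=
  volume.withDensity (fun x => ENNReal.ofReal (tssDensity α σ k t x))

/-- The drift term `Γ_t = ∫_0^1 x 𝒱_t(x) dx`. -/
noncomputable def tssGamma (α : ℝ) (σ k : ℝ≥0 → ℝ) (t : ℝ≥0) : ℝ :=
  ∫ x in (0 : ℝ)..1, x * tssDensity α σ k t x

/-- The conditions on the parameters `α`, `σ_t`, `k_t`. Only the values at positive times
matter; in particular `k_t` may tend to `0` as `t` goes to `0`. -/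
structure IsTSSParameters (α : ℝ) (σ k : ℝ≥0 → ℝ) : Prop where
  alpha_nonneg : 0 ≤ α
  alpha_lt_one : α < 1
  sigma_pos : ∀ t, 0 < t → 0 < σ t
  k_pos : ∀ t, 0 < t → 0 < k t
  sigma_continuousOn : ContinuousOn σ (Set.Ioi 0)
  k_continuousOn : ContinuousOn k (Set.Ioi 0)
  tendsto_sigma_sq : Tendsto (fun t : ℝ≥0 => (t : ℝ) * (σ t) ^ 2) (𝓝[>] 0) (𝓝 0)
  tendsto_scale : Tendsto (fun t : ℝ≥0 => (t : ℝ) / (k t) ^ (1 - α) * (σ t) ^ (2 * α))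
    (𝓝[>] 0) (𝓝 0)
  monotoneOn_scale : MonotoneOn (fun t : ℝ≥0 => (t : ℝ) / (k t) ^ (1 - α) * (σ t) ^ (2 * α))
    (Set.Ioi 0)
  monotoneOn_sigma_sq_mul_k : MonotoneOn (fun t : ℝ≥0 => (σ t) ^ 2 * k t) (Set.Ioi 0)

/-- `Z` is an additive tempered stable subordinator: an additive process whose family of
generating triplets is `(0, 𝒱_t, Γ_t)`. -/
structure IsTSS {Ω : Type*} [MeasurableSpace Ω] (α : ℝ) (σ k : ℝ≥0 → ℝ) (Z : ℝ≥0 → Ω → ℝ)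
    (P : Measure Ω) : Prop where
  additive : IsAdditiveProcess Z P
  triplet : ∀ t, HasGeneratingTriplet (P.map (Z t)) 0 (tssLevyMeasure α σ k t) (tssGamma α σ k t)

/-! For fixed $x>0$ the density $\mathcal V_t(x)$ is a constant times the scale
$t\sigma_t^{2\alpha}/k_t^{1-\alpha}$ times $e^{-(1-\alpha)x/(\sigma_t^2k_t)}$. By the monotonicity
hypotheses both factors, hence the regions under the graphs, grow with $t$.

Existence: take a Poisson process on the plane with Lebesgue intensity and let $Z_t$ be the sum of
the abscissae of the points under the graph of $\mathcal V_t$. Nested regions give non-decreasing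
paths, and increments that use disjoint sets of points, hence are independent
(`iIndepFun_poissonSum`). Campbell's formula (`integral_cexp_poissonSum`) gives the law of $Z_t$.
The mean $t\sigma_t^2$ is finite, so the sums converge, and it is continuous in $t$, so $Z$ is
continuous in $L^1$ and thus in probability.

An arbitrary TSS: the law of $Z_t$ is prescribed, and characteristic functions of exponential form
have no zeros. Independence of $Z_s$ and $Z_t-Z_s$ therefore determines the law of the increment
(`IsTSS.map_sub_eq`), which must be that of the constructed process and so sits on $[0,\infty)$.
Right-continuity passes from a countable dense set of times to all times. The drift and
integrability claims follow from $\int x\,\mathcal V_t(x)\,dx<\infty$. -/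

/-! ### Sums over Poisson point processes and Campbell's formulas. -/

section PoissonRandomSums

variable {E : Type*} [MeasurableSpace E]

/-- The sum of the values of `g` over the first `p.1` points of the sequence `p.2`. -/
def blockSum {M : Type*} [AddCommMonoid M] (g : E → M) (p : ℕ × (ℕ → E)) : M :=
  ∑ i ∈ Finset.range p.1, g (p.2 i)

/-- The law of a Poisson number of points together with an independent i.i.d. sequence. -/
noncomputable def poissonBlock (r : ℝ≥0) (ρ : Measure E) : Measure (ℕ × (ℕ → E)) :=
  (poissonMeasure r).prod (Measure.infinitePi fun _ => ρ)

instance (r : ℝ≥0) (ρ : Measure E) [IsProbabilityMeasure ρ] :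
    IsProbabilityMeasure (poissonBlock r ρ) := by
  unfold poissonBlock; infer_instance

lemma measurable_blockSum {M : Type*} [AddCommMonoid M] [MeasurableSpace M] [MeasurableAdd₂ M]
    {g : E → M} (hg : Measurable g) : Measurable (blockSum g) := by
  refine measurable_from_prod_countable_right fun n => ?_
  simp only [blockSum]
  fun_prop

lemma tsum_ofReal_poisson_mul_natCast (r : ℝ≥0) :
    ∑' n : ℕ, ENNReal.ofReal (Real.exp (-r) * r ^ n / n.factorial) * (n : ℝ≥0∞) = r := by
  have h1 := hasSum_one_poissonMeasure r
  have h2 : HasSum (fun n : ℕ => Real.exp (-r) * (r : ℝ) ^ n / n.factorial * n) r := by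
    -- The term $n=0$ vanishes; since $n/n!=1/(n-1)!$, the shifted series is $r$ times the total
    -- mass.
    rw [← hasSum_nat_add_iff' 1]
    simp only [Finset.range_one, Finset.sum_singleton, Nat.cast_zero, mul_zero, sub_zero]
    convert! h1.mul_left (r : ℝ) using 1
    · ext n
      rw [Nat.factorial_succ]
      have : (n.factorial : ℝ) ≠ 0 := by positivity
      push_cast
      field_simp
      ring
    · simp
  have h3 : ∀ n : ℕ, ENNReal.ofReal (Real.exp (-r) * r ^ n / n.factorial) * (n : ℝ≥0∞)
      = ENNReal.ofReal (Real.exp (-r) * (r : ℝ) ^ n / n.factorial * n) := fun n => by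
    rw [ENNReal.ofReal_mul (by positivity), ENNReal.ofReal_natCast]
  simp_rw [h3]
  rw [← ENNReal.ofReal_tsum_of_nonneg (fun n => by positivity) h2.summable, h2.tsum_eq,
    ENNReal.ofReal_coe_nnreal]

lemma lintegral_blockSum (r : ℝ≥0) (ρ : Measure E) [IsProbabilityMeasure ρ] {g : E → ℝ≥0∞}
    (hg : Measurable g) : ∫⁻ p, blockSum g p ∂(poissonBlock r ρ) = r * ∫⁻ x, g x ∂ρ := by
  rw [poissonBlock, lintegral_prod _ (measurable_blockSum hg).aemeasurable]
  have h : ∀ n : ℕ, ∫⁻ X : ℕ → E, blockSum g (n, X) ∂(Measure.infinitePi fun _ => ρ)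
      = n * ∫⁻ x, g x ∂ρ := fun n => by
    simp only [blockSum]
    rw [lintegral_finsetSum _ fun i _ => by fun_prop]
    have h' : ∀ i : ℕ, ∫⁻ X : ℕ → E, g (X i) ∂(Measure.infinitePi fun _ => ρ) = ∫⁻ x, g x ∂ρ :=
      fun i => (measurePreserving_eval_infinitePi (fun _ : ℕ => ρ) i).lintegral_comp hg
    simp [h']
  simp_rw [h]
  rw [lintegral_mul_const _ (by fun_prop), poissonMeasure, lintegral_sum_measure]
  simp only [lintegral_smul_measure, lintegral_dirac, smul_eq_mul]
  rw [tsum_ofReal_poisson_mul_natCast]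

/-- Compound Poisson law: given $n$ points, independence yields $z^n$ with $z$ the one-point
expectation, and the Poisson generating function at $z$ is $e^{r(z-1)}$. -/
lemma integral_cexp_blockSum (r : ℝ≥0) (ρ : Measure E) [IsProbabilityMeasure ρ] {g : E → ℝ}
    (hg : Measurable g) :
    ∫ p, Complex.exp (Complex.I * (blockSum g p : ℝ)) ∂(poissonBlock r ρ)
      = Complex.exp (r * ∫ x, (Complex.exp (Complex.I * (g x : ℝ)) - 1) ∂ρ) := by
  have hm : Measurable fun p : ℕ × (ℕ → E) => Complex.exp (Complex.I * (blockSum g p : ℝ)) := by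
    have := measurable_blockSum hg
    fun_prop
  have hbd : ∀ x : ℝ, ‖Complex.exp (Complex.I * x)‖ = 1 := fun x => by
    rw [mul_comm]; exact Complex.norm_exp_ofReal_mul_I x
  have hint : Integrable (fun p : ℕ × (ℕ → E) => Complex.exp (Complex.I * (blockSum g p : ℝ)))
      (poissonBlock r ρ) :=
    Integrable.of_bound hm.aestronglyMeasurable 1 (ae_of_all _ fun p => (hbd _).le)
  rw [poissonBlock] at hint ⊢
  rw [integral_prod _ hint]
  have h : ∀ n : ℕ, ∫ X : ℕ → E, Complex.exp (Complex.I * (blockSum g (n, X) : ℝ))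
      ∂(Measure.infinitePi fun _ => ρ) = (∫ x, Complex.exp (Complex.I * (g x : ℝ)) ∂ρ) ^ n :=
    fun n => by
    have hi : iIndepFun (fun (i : Fin n) (X : ℕ → E) => Complex.exp (Complex.I * (g (X i) : ℝ)))
        (Measure.infinitePi fun _ => ρ) :=
      (iIndepFun_infinitePi (P := fun _ : ℕ => ρ)
        (X := fun _ x => Complex.exp (Complex.I * (g x : ℝ)))
        (fun _ => by fun_prop)).precomp Fin.val_injective
    have h1 := hi.integral_fun_prod_eq_prod_integral
      (fun i => (Measurable.aestronglyMeasurable (by fun_prop)))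
    have h2 : ∀ i : Fin n, ∫ X : ℕ → E, Complex.exp (Complex.I * (g (X i) : ℝ))
        ∂(Measure.infinitePi fun _ => ρ) = ∫ x, Complex.exp (Complex.I * (g x : ℝ)) ∂ρ := fun i => by
      rw [← integral_map (φ := fun X : ℕ → E => X i)
        (f := fun x => Complex.exp (Complex.I * (g x : ℝ))) (measurable_pi_apply _).aemeasurable
        (Measurable.aestronglyMeasurable (by fun_prop)),
        Measure.infinitePi_map_eval (fun _ : ℕ => ρ) i]
    simp only [h2, Finset.prod_const, Finset.card_univ, Fintype.card_fin] at h1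
    rw [← h1]
    congr 1
    ext X
    rw [blockSum, Complex.ofReal_sum, Finset.mul_sum, Complex.exp_sum,
      Finset.prod_range fun i => Complex.exp (Complex.I * (g (X i) : ℝ))]
  simp_rw [h]
  rw [integral_poissonMeasure]
  set z := ∫ x, Complex.exp (Complex.I * (g x : ℝ)) ∂ρ
  have hz : ∫ x, (Complex.exp (Complex.I * (g x : ℝ)) - 1) ∂ρ = z - 1 := by
    rw [integral_sub _ (integrable_const _)]
    · simp [z]
    · exact Integrable.of_bound (Measurable.aestronglyMeasurable (by fun_prop)) 1
        (ae_of_all _ fun p => (hbd _).le)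
  rw [hz, show (r : ℂ) * (z - 1) = -r + r * z by ring, Complex.exp_add]
  have h3 := (NormedSpace.expSeries_div_hasSum_exp ((r : ℂ) * z)).mul_left (Complex.exp (-r))
  rw [← Complex.exp_eq_exp_ℂ] at h3
  rw [← h3.tsum_eq]
  congr 1
  ext n
  rw [Complex.real_smul]
  push_cast
  ring

/-- Poisson points on `E` organised in independent blocks. -/
noncomputable def poissonSpace (r : ℕ → ℝ≥0) (ρ : ℕ → Measure E) :
    Measure (ℕ → ℕ × (ℕ → E)) :=
  Measure.infinitePi fun n => poissonBlock (r n) (ρ n)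

/-- The intensity measure of the points of `poissonSpace r ρ`. -/
noncomputable def poissonIntensity (r : ℕ → ℝ≥0) (ρ : ℕ → Measure E) : Measure E :=
  Measure.sum fun n => r n • ρ n

/-- The sum of the values of `g` over all the points of a configuration. -/
noncomputable def poissonSum (g : E → ℝ) (ω : ℕ → ℕ × (ℕ → E)) : ℝ :=
  ∑' n, blockSum g (ω n)

/-- An s-finite measure is a countable sum of finite ones, and each of these is its mass times a
probability measure. A zero summand gets rate $0$ and an arbitrary Dirac mass. -/
lemma exists_poissonIntensity_eq [Nonempty E] (μ : Measure E) [SFinite μ] :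
    ∃ (r : ℕ → ℝ≥0) (ρ : ℕ → Measure E), (∀ n, IsProbabilityMeasure (ρ n)) ∧
      poissonIntensity r ρ = μ := by
  have h : ∀ n, ∃ (r : ℝ≥0) (ρ : Measure E), IsProbabilityMeasure ρ ∧
      r • ρ = sfiniteSeq μ n := fun n => by
    by_cases h0 : sfiniteSeq μ n = 0
    · exact ⟨0, Measure.dirac (Classical.arbitrary E), inferInstance, by simp [h0]⟩
    · have hu : sfiniteSeq μ n Set.univ ≠ 0 := by simpa using h0
      refine ⟨(sfiniteSeq μ n Set.univ).toNNReal,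
        (sfiniteSeq μ n Set.univ)⁻¹ • sfiniteSeq μ n, ⟨?_⟩, ?_⟩
      · simp [ENNReal.inv_mul_cancel hu (measure_ne_top _ _)]
      · ext s
        simp only [Measure.smul_apply, smul_eq_mul, ENNReal.smul_def]
        rw [ENNReal.coe_toNNReal (measure_ne_top _ _), ← mul_assoc,
          ENNReal.mul_inv_cancel hu (measure_ne_top _ _), one_mul]
  choose r ρ hρ h using h
  exact ⟨r, ρ, hρ, by simp only [poissonIntensity, h, sum_sfiniteSeq]⟩

variable (r : ℕ → ℝ≥0) (ρ : ℕ → Measure E) [∀ n, IsProbabilityMeasure (ρ n)]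

instance : IsProbabilityMeasure (poissonSpace r ρ) := by
  unfold poissonSpace; infer_instance

lemma lintegral_tsum_blockSum {g : E → ℝ≥0∞} (hg : Measurable g) :
    ∫⁻ ω, ∑' n, blockSum g (ω n) ∂(poissonSpace r ρ) = ∫⁻ x, g x ∂(poissonIntensity r ρ) := by
  have hm := measurable_blockSum hg
  have hm' : ∀ n, Measurable fun ω : ℕ → ℕ × (ℕ → E) => blockSum g (ω n) :=
    fun n => hm.comp (measurable_pi_apply n)
  rw [lintegral_tsum fun n => (hm' n).aemeasurable, poissonIntensity,
    lintegral_sum_measure]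
  congr 1
  ext n
  rw [lintegral_smul_measure, ENNReal.smul_def, smul_eq_mul, ← lintegral_blockSum _ _ hg]
  exact (measurePreserving_eval_infinitePi (fun n => poissonBlock (r n) (ρ n)) n).lintegral_comp hm

lemma enorm_blockSum_le {F : Type*} (g : F → ℝ) (p : ℕ × (ℕ → F)) :
    ‖blockSum g p‖ₑ ≤ blockSum (fun x => ‖g x‖ₑ) p :=
  enorm_sum_le _ _

lemma enorm_poissonSum_le {F : Type*} (g : F → ℝ) (ω : ℕ → ℕ × (ℕ → F)) :
    ‖poissonSum g ω‖ₑ ≤ ∑' n, blockSum (fun x => ‖g x‖ₑ) (ω n) := by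
  refine (enorm_tsum_le_tsum_enorm).trans ?_
  exact ENNReal.tsum_le_tsum fun n => enorm_blockSum_le g (ω n)

lemma lintegral_enorm_poissonSum_le {g : E → ℝ} (hg : Measurable g) :
    ∫⁻ ω, ‖poissonSum g ω‖ₑ ∂(poissonSpace r ρ) ≤ ∫⁻ x, ‖g x‖ₑ ∂(poissonIntensity r ρ) := by
  rw [← lintegral_tsum_blockSum r ρ hg.enorm]
  exact lintegral_mono fun ω => enorm_poissonSum_le g ω

/-- The sum of $|g|$ over all points has finite expectation, so it is almost surely finite. -/
lemma ae_summable_blockSum {g : E → ℝ} (hg : Measurable g)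
    (hi : Integrable g (poissonIntensity r ρ)) :
    ∀ᵐ ω ∂(poissonSpace r ρ), Summable fun n => blockSum g (ω n) := by
  have h : ∀ᵐ ω ∂(poissonSpace r ρ), ∑' n, blockSum (fun x => ‖g x‖ₑ) (ω n) < ∞ := by
    refine ae_lt_top ?_ ?_
    · have := measurable_blockSum hg.enorm
      exact Measurable.tsum fun n => this.comp (measurable_pi_apply n)
    · rw [lintegral_tsum_blockSum r ρ hg.enorm]
      exact hi.2.ne
  filter_upwards [h] with ω hω
  refine Summable.of_norm ?_
  simpa only [toReal_enorm] using ENNReal.summable_toReal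
    ((ENNReal.tsum_le_tsum fun n => enorm_blockSum_le g (ω n)).trans_lt hω).ne

lemma measurable_poissonSum {g : E → ℝ} (hg : Measurable g) : Measurable (poissonSum g) := by
  have := measurable_blockSum hg
  exact Measurable.tsum fun n => this.comp (measurable_pi_apply n)

lemma integrable_cexp_sub_one {μ : Measure E} {g : E → ℝ} (hg : Integrable g μ) :
    Integrable (fun x => Complex.exp (Complex.I * (g x : ℝ)) - 1) μ := by
  refine hg.mono (Continuous.comp_aestronglyMeasurable
    (g := fun x : ℝ => Complex.exp (Complex.I * x) - 1) (by fun_prop) hg.1)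
    (ae_of_all _ fun x => ?_)
  exact Real.norm_exp_I_mul_ofReal_sub_one_le

/-- Campbell's formula for the characteristic functional of a Poisson point process. -/
lemma integral_cexp_poissonSum {g : E → ℝ} (hg : Measurable g)
    (hi : Integrable g (poissonIntensity r ρ)) :
    ∫ ω, Complex.exp (Complex.I * (poissonSum g ω : ℝ)) ∂(poissonSpace r ρ)
      = Complex.exp (∫ x, (Complex.exp (Complex.I * (g x : ℝ)) - 1) ∂(poissonIntensity r ρ)) := by
  have hm := measurable_blockSum hg
  have h1 : ∀ n, ∫ ω, Complex.exp (Complex.I * (∑ i ∈ Finset.range n, blockSum g (ω i) : ℝ))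
      ∂(poissonSpace r ρ) = Complex.exp (∑ i ∈ Finset.range n,
        ∫ x, (Complex.exp (Complex.I * (g x : ℝ)) - 1) ∂(r i • ρ i)) := fun n => by
    have hi : iIndepFun (fun (i : Fin n) (ω : ℕ → ℕ × (ℕ → E)) =>
        Complex.exp (Complex.I * (blockSum g (ω i) : ℝ))) (poissonSpace r ρ) :=
      (iIndepFun_infinitePi (P := fun n => poissonBlock (r n) (ρ n))
        (X := fun _ x => Complex.exp (Complex.I * (blockSum g x : ℝ)))
        (fun _ => by fun_prop)).precomp Fin.val_injective
    have h1 := hi.integral_fun_prod_eq_prod_integral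
      (fun i => (Measurable.aestronglyMeasurable (by fun_prop)))
    have h2 : ∀ i : ℕ, ∫ ω, Complex.exp (Complex.I * (blockSum g (ω i) : ℝ))
        ∂(poissonSpace r ρ) = Complex.exp (∫ x, (Complex.exp (Complex.I * (g x : ℝ)) - 1)
          ∂(r i • ρ i)) := fun i => by
      rw [integral_smul_nnreal_measure, NNReal.smul_def, Complex.real_smul,
        ← integral_cexp_blockSum _ _ hg, poissonSpace,
        ← integral_map (φ := fun ω : ℕ → ℕ × (ℕ → E) => ω i)
        (f := fun x => Complex.exp (Complex.I * (blockSum g x : ℝ)))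
        (measurable_pi_apply _).aemeasurable
        (Measurable.aestronglyMeasurable (by fun_prop)),
        Measure.infinitePi_map_eval]
    simp only [h2, ← Complex.exp_sum] at h1
    rw [Finset.sum_range, ← h1]
    congr 1
    ext ω
    rw [Complex.ofReal_sum, Finset.mul_sum, Finset.sum_range]
  have h2 := (hasSum_integral_measure (integrable_cexp_sub_one hi)).tendsto_sum_nat
  refine tendsto_nhds_unique ?_ ((Complex.continuous_exp.tendsto _).comp h2)
  simp only [Function.comp_def, ← h1]
  -- Partial sums over blocks converge almost surely, and the exponentials have modulus $1$.
  refine tendsto_integral_of_dominated_convergence (fun _ => 1)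
    (fun n => Measurable.aestronglyMeasurable (by fun_prop)) (integrable_const _)
    (fun n => ae_of_all _ fun ω => ?_) ?_
  · rw [mul_comm]; exact (Complex.norm_exp_ofReal_mul_I _).le
  · filter_upwards [ae_summable_blockSum r ρ hg hi] with ω hω
    have h3 : Continuous fun x : ℝ => Complex.exp (Complex.I * x) := by fun_prop
    exact (h3.tendsto _).comp hω.hasSum.tendsto_sum_nat

lemma charFun_map_poissonSum {g : E → ℝ} (hg : Measurable g)
    (hi : Integrable g (poissonIntensity r ρ)) (u : ℝ) :
    charFun ((poissonSpace r ρ).map (poissonSum g)) u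
      = Complex.exp (∫ x, (Complex.exp (Complex.I * u * (g x : ℝ)) - 1)
        ∂(poissonIntensity r ρ)) := by
  have h := integral_cexp_poissonSum r ρ (hg.const_mul u) (hi.const_mul u)
  have h1 : ∀ ω, poissonSum (fun x => u * g x) ω = u * poissonSum g ω := fun ω => by
    simp only [poissonSum, blockSum, ← Finset.mul_sum, tsum_mul_left]
  simp only [h1, Complex.ofReal_mul, ← mul_assoc] at h
  rw [← h, charFun_apply_real, integral_map (measurable_poissonSum hg).aemeasurable
    (Measurable.aestronglyMeasurable (by fun_prop))]
  congr 1
  ext ω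
  ring_nf

/-- Sums of functions with disjoint supports over a Poisson point process are independent. -/
lemma iIndepFun_poissonSum {ι : Type*} [Fintype ι] {g : ι → E → ℝ}
    (hg : ∀ j, Measurable (g j)) (hi : ∀ j, Integrable (g j) (poissonIntensity r ρ))
    (hd : ∀ x, ∀ i j, g i x ≠ 0 → g j x ≠ 0 → i = j) :
    iIndepFun (fun j => poissonSum (g j)) (poissonSpace r ρ) := by
  classical
  rw [iIndepFun_iff_charFun_pi fun j => (measurable_poissonSum (hg j)).aemeasurable]
  intro t
  simp only [charFun_map_poissonSum r ρ (hg _) (hi _), ← Complex.exp_sum]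
  have h0 : ∀ j, Integrable (fun x => Complex.exp (Complex.I * (t j) * (g j x : ℝ)) - 1)
      (poissonIntensity r ρ) := fun j => by
    have := integrable_cexp_sub_one ((hi j).const_mul (t j))
    simpa only [Complex.ofReal_mul, ← mul_assoc] using this
  rw [← integral_finsetSum _ fun j _ => h0 j]
  -- The joint characteristic function at $t$ is that of a single Poisson sum, over the linear
  -- combination $\sum_j t_jg_j$.
  have h := integral_cexp_poissonSum r ρ (g := fun x => ∑ j, t j * g j x) (by fun_prop)
    (integrable_finsetSum _ fun j _ => (hi j).const_mul _)
  have hm : Measurable fun ω => WithLp.toLp 2 fun j => poissonSum (g j) ω := by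
    have := fun j => measurable_poissonSum (hg j)
    fun_prop
  rw [charFun_apply, integral_map hm.aemeasurable
    (Continuous.aestronglyMeasurable (by fun_prop))]
  convert! h using 1
  · refine integral_congr_ae ?_
    filter_upwards [ae_all_iff.2 fun j => ae_summable_blockSum r ρ (hg j) (hi j)] with ω hω
    rw [mul_comm]
    congr 3
    simp only [PiLp.inner_apply, RCLike.inner_apply, conj_trivial, poissonSum, ← tsum_mul_left]
    rw [← Summable.tsum_finsetSum fun j _ => (hω j).mul_left (t j)]
    congr 1
    ext n
    simp only [blockSum, Finset.mul_sum]
    rw [Finset.sum_comm]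
  · congr 2
    ext x
    -- At most one $g_j(x)$ is nonzero, so $e^{i\sum_j t_jg_j}-1=\sum_j(e^{it_jg_j}-1)$ pointwise.
    by_cases hx : ∃ i, g i x ≠ 0
    · obtain ⟨i, hx⟩ := hx
      have h1 : ∀ j, j ≠ i → g j x = 0 := fun j hj => by
        by_contra hne
        exact hj (hd x j i hne hx)
      rw [Finset.sum_eq_single i (fun j _ hj => by simp [h1 j hj]) (by simp),
        Finset.sum_eq_single i (fun j _ hj => by simp [h1 j hj]) (by simp)]
      push_cast
      rw [mul_assoc]
    · push Not at hx
      simp [hx]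

end PoissonRandomSums

/-! ### The tempered stable Lévy density: monotonicity, continuity, mean and exponent. -/

section TemperedStableDensity

variable {α : ℝ} {σ k : ℝ≥0 → ℝ}

lemma tssDensity_of_nonpos (α : ℝ) (σ k : ℝ≥0 → ℝ) (t : ℝ≥0) {x : ℝ} (hx : x ≤ 0) :
    tssDensity α σ k t x = 0 := by
  simp [tssDensity, hx]

lemma tssDensity_zero (α : ℝ) (σ k : ℝ≥0 → ℝ) (x : ℝ) : tssDensity α σ k 0 x = 0 := by
  simp [tssDensity, Set.indicator]

/-- Isolates the two $t$-dependent factors to which the monotonicity hypotheses apply. At $t=0$ both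
sides vanish through the factor $t$, whatever $\sigma_0$ and $k_0$ are. -/
lemma tssDensity_of_pos (h : IsTSSParameters α σ k) (t : ℝ≥0) {x : ℝ} (hx : 0 < x) :
    tssDensity α σ k t x = (1 - α) ^ (1 - α) / Real.Gamma (1 - α) / x ^ (1 + α)
      * ((t : ℝ) / (k t) ^ (1 - α) * (σ t) ^ (2 * α))
      * Real.exp (-((1 - α) * x / ((σ t) ^ 2 * k t))) := by
  rcases eq_zero_or_pos t with rfl | ht
  · simp [tssDensity_zero]
  · have hk := h.k_pos t ht
    have hα : 0 ≤ 1 - α := sub_nonneg.2 h.alpha_lt_one.le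
    simp only [tssDensity, Set.indicator, Set.mem_Ioi, hx, if_true, neg_mul, neg_div,
      Real.div_rpow hα hk.le]
    ring

lemma measurable_tssDensity (α : ℝ) (σ k : ℝ≥0 → ℝ) (t : ℝ≥0) :
    Measurable (tssDensity α σ k t) := by
  unfold tssDensity
  exact Measurable.indicator (by fun_prop) measurableSet_Ioi

lemma tssScale_nonneg (h : IsTSSParameters α σ k) (t : ℝ≥0) :
    0 ≤ (t : ℝ) / (k t) ^ (1 - α) * (σ t) ^ (2 * α) := by
  rcases eq_zero_or_pos t with rfl | ht
  · simp
  · have := h.k_pos t ht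
    have := h.sigma_pos t ht
    positivity

lemma tssConst_nonneg (h : IsTSSParameters α σ k) {x : ℝ} (hx : 0 < x) :
    0 ≤ (1 - α) ^ (1 - α) / Real.Gamma (1 - α) / x ^ (1 + α) := by
  have hα : 0 < 1 - α := sub_pos.2 h.alpha_lt_one
  have := Real.Gamma_pos_of_pos hα
  positivity

lemma tssDensity_nonneg (h : IsTSSParameters α σ k) (t : ℝ≥0) (x : ℝ) :
    0 ≤ tssDensity α σ k t x := by
  rcases le_or_gt x 0 with hx | hx
  · rw [tssDensity_of_nonpos _ _ _ _ hx]
  · rw [tssDensity_of_pos h t hx]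
    have := tssScale_nonneg h t
    have := tssConst_nonneg h hx
    positivity

lemma tssDensity_mono (h : IsTSSParameters α σ k) (x : ℝ) :
    Monotone fun t => tssDensity α σ k t x := by
  intro s t hst
  rcases eq_zero_or_pos s with rfl | hs
  · simpa only [tssDensity_zero] using tssDensity_nonneg h t x
  rcases le_or_gt x 0 with hx | hx
  · simp only [tssDensity_of_nonpos _ _ _ _ hx, le_refl]
  have ht : 0 < t := hs.trans_le hst
  simp only [tssDensity_of_pos h _ hx]
  have h1 := h.monotoneOn_scale hs ht hst
  have h2 := h.monotoneOn_sigma_sq_mul_k hs ht hst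
  have h3 : 0 < (σ s) ^ 2 * k s := mul_pos (pow_pos (h.sigma_pos s hs) 2) (h.k_pos s hs)
  have hα : 0 ≤ 1 - α := sub_nonneg.2 h.alpha_lt_one.le
  have := tssScale_nonneg h t
  have := tssConst_nonneg h hx
  simp only at h1 h2
  gcongr

lemma continuousAt_tss_param (h : IsTSSParameters α σ k) {t : ℝ≥0} (ht : 0 < t) :
    ContinuousAt σ t ∧ ContinuousAt k t :=
  ⟨h.sigma_continuousOn.continuousAt (Ioi_mem_nhds ht),
    h.k_continuousOn.continuousAt (Ioi_mem_nhds ht)⟩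

lemma nnreal_continuousAt_zero_iff {X : Type*} [TopologicalSpace X] {f : ℝ≥0 → X} :
    ContinuousAt f 0 ↔ Tendsto f (𝓝[>] 0) (𝓝 (f 0)) := by
  rw [continuousAt_iff_punctured_nhds]
  congr! 2
  ext x
  simp [pos_iff_ne_zero]

lemma continuous_tssDensity (h : IsTSSParameters α σ k) (x : ℝ) :
    Continuous fun t => tssDensity α σ k t x := by
  rcases le_or_gt x 0 with hx | hx
  · simp only [tssDensity_of_nonpos _ _ _ _ hx, continuous_const]
  rw [continuous_iff_continuousAt]
  intro t
  rcases eq_zero_or_pos t with rfl | ht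
  -- At $0$ the exponential factor is at most $1$, so the density is squeezed by a constant times
  -- the scale, which tends to $0$.
  · rw [nnreal_continuousAt_zero_iff, tssDensity_zero]
    have h1 := h.tendsto_scale.const_mul ((1 - α) ^ (1 - α) / Real.Gamma (1 - α) / x ^ (1 + α))
    rw [mul_zero] at h1
    refine squeeze_zero' (Eventually.of_forall fun t => tssDensity_nonneg h t x) ?_ h1
    filter_upwards [self_mem_nhdsWithin] with t (ht : 0 < t)
    rw [tssDensity_of_pos h t hx]
    have := tssScale_nonneg h t
    have := tssConst_nonneg h hx
    have h3 := h.sigma_pos t ht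
    have h4 := h.k_pos t ht
    have hα : 0 ≤ 1 - α := sub_nonneg.2 h.alpha_lt_one.le
    refine mul_le_of_le_one_right (by positivity) ?_
    rw [Real.exp_le_one_iff, neg_nonpos]
    positivity
  · obtain ⟨h1, h2⟩ := continuousAt_tss_param h ht
    have h3 := (h.sigma_pos t ht).ne'
    have h4 := h.k_pos t ht
    simp only [tssDensity_of_pos h _ hx]
    have h5 : ContinuousAt (fun t : ℝ≥0 => (k t) ^ (1 - α)) t :=
      h2.rpow_const (Or.inl h4.ne')
    have h6 : ContinuousAt (fun t : ℝ≥0 => (σ t) ^ (2 * α)) t :=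
      h1.rpow_const (Or.inl h3)
    have h7 : (k t) ^ (1 - α) ≠ 0 := (Real.rpow_pos_of_pos h4 _).ne'
    have h8 : (σ t) ^ 2 * k t ≠ 0 := mul_ne_zero (pow_ne_zero 2 h3) h4.ne'
    refine ((continuousAt_const).mul (((NNReal.continuous_coe.continuousAt).div h5 h7).mul
      h6)).mul ?_
    refine Real.continuous_exp.continuousAt.comp (ContinuousAt.neg ?_)
    exact continuousAt_const.div ((h1.pow 2).mul h2) h8

/-- The factor $x$ turns $x^{-1-\alpha}$ into $x^{(1-\alpha)-1}$, a Gamma integrand, integrable at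
$0$ because $\alpha<1$. -/
lemma mul_tssDensity_eq (α : ℝ) (σ k : ℝ≥0 → ℝ) (t : ℝ≥0) :
    (fun x => x * tssDensity α σ k t x) = (Set.Ioi 0).indicator fun x =>
      (t : ℝ) * (σ t) ^ (2 * α) / Real.Gamma (1 - α) * ((1 - α) / k t) ^ (1 - α)
        * (x ^ ((1 - α) - 1) * Real.exp (-((1 - α) / ((σ t) ^ 2 * k t) * x))) := by
  ext x
  by_cases hx : x ∈ Set.Ioi (0 : ℝ)
  · simp only [tssDensity, Set.indicator_of_mem hx]
    have hx' : (0 : ℝ) < x := hx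
    have h1 : x * (1 / x ^ (1 + α)) = x ^ ((1 - α) - 1) := by
      rw [show (1 - α) - 1 = 1 - (1 + α) by ring, Real.rpow_sub hx', Real.rpow_one]
      ring
    rw [← h1]
    ring_nf
  · simp [tssDensity, Set.indicator_of_notMem hx]

lemma integrable_mul_tssDensity (h : IsTSSParameters α σ k) (t : ℝ≥0) :
    Integrable fun x => x * tssDensity α σ k t x := by
  rcases eq_zero_or_pos t with rfl | ht
  · simp [tssDensity_zero]
  rw [mul_tssDensity_eq, integrable_indicator_iff measurableSet_Ioi]
  refine Integrable.const_mul ?_ _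
  have hα : 0 < 1 - α := sub_pos.2 h.alpha_lt_one
  have h3 := h.sigma_pos t ht
  have h4 := h.k_pos t ht
  have := integrableOn_rpow_mul_exp_neg_mul_rpow (p := 1) (s := (1 - α) - 1)
    (b := (1 - α) / ((σ t) ^ 2 * k t)) (by linarith) one_pos (by positivity)
  simpa only [IntegrableOn, Real.rpow_one, neg_mul] using this

/-- The mean of the tempered stable Lévy measure at time `t` is `t σ_t²`. -/
lemma integral_mul_tssDensity (h : IsTSSParameters α σ k) (t : ℝ≥0) :
    ∫ x, x * tssDensity α σ k t x = t * (σ t) ^ 2 := by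
  rcases eq_zero_or_pos t with rfl | ht
  · simp [tssDensity_zero]
  have hα : 0 < 1 - α := sub_pos.2 h.alpha_lt_one
  have h3 := h.sigma_pos t ht
  have h4 := h.k_pos t ht
  have hG := Real.Gamma_pos_of_pos hα
  rw [mul_tssDensity_eq, integral_indicator measurableSet_Ioi, integral_const_mul,
    Real.integral_rpow_mul_exp_neg_mul_Ioi hα (by positivity)]
  have h5 : ((1 - α) / k t) ^ (1 - α) * (1 / ((1 - α) / ((σ t) ^ 2 * k t))) ^ (1 - α)
      = (σ t) ^ (2 * (1 - α)) := by
    rw [← Real.mul_rpow (by positivity) (by positivity), Real.rpow_mul h3.le, Real.rpow_two]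
    congr 1
    field_simp
  have h6 : (σ t) ^ (2 * α) * (σ t) ^ (2 * (1 - α)) = (σ t) ^ 2 := by
    rw [← Real.rpow_add h3, ← Real.rpow_two]
    congr 1
    ring
  calc _ = t * ((σ t) ^ (2 * α) * (((1 - α) / k t) ^ (1 - α)
      * (1 / ((1 - α) / ((σ t) ^ 2 * k t))) ^ (1 - α))) := by field_simp
    _ = _ := by rw [h5, h6]

lemma continuous_tssMean (h : IsTSSParameters α σ k) :
    Continuous fun t : ℝ≥0 => (t : ℝ) * (σ t) ^ 2 := by
  rw [continuous_iff_continuousAt]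
  intro t
  rcases eq_zero_or_pos t with rfl | ht
  · rw [nnreal_continuousAt_zero_iff]
    simpa using h.tendsto_sigma_sq
  · obtain ⟨h1, -⟩ := continuousAt_tss_param h ht
    exact NNReal.continuous_coe.continuousAt.mul (h1.pow 2)

lemma tssLevyMeasure_Iic (α : ℝ) (σ k : ℝ≥0 → ℝ) (t : ℝ≥0) :
    tssLevyMeasure α σ k t (Set.Iic 0) = 0 := by
  rw [tssLevyMeasure, withDensity_apply _ measurableSet_Iic,
    setLIntegral_congr_fun measurableSet_Iic (g := fun _ => 0)
      fun x (hx : x ≤ 0) => by simp [tssDensity_of_nonpos _ _ _ _ hx]]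
  simp

lemma tssLevyMeasure_restrict_eq {s u : Set ℝ} (hsu : s ∩ Set.Ioi 0 = u ∩ Set.Ioi 0)
    (α : ℝ) (σ k : ℝ≥0 → ℝ) (t : ℝ≥0) :
    (tssLevyMeasure α σ k t).restrict s = (tssLevyMeasure α σ k t).restrict u := by
  refine Measure.restrict_congr_set ?_
  have : ∀ᵐ x ∂(tssLevyMeasure α σ k t), x ∉ Set.Iic 0 :=
    measure_eq_zero_iff_ae_notMem.1 (tssLevyMeasure_Iic α σ k t)
  filter_upwards [this] with x hx
  have hx' : x ∈ Set.Ioi (0 : ℝ) := by simpa using hx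
  have := Set.ext_iff.1 hsu x
  simp only [Set.mem_inter_iff, hx', and_true] at this
  exact propext this

lemma integral_tssLevyMeasure {F : Type*} [NormedAddCommGroup F] [NormedSpace ℝ F]
    (h : IsTSSParameters α σ k) (t : ℝ≥0) (g : ℝ → F) :
    ∫ x, g x ∂(tssLevyMeasure α σ k t) = ∫ x, tssDensity α σ k t x • g x := by
  rw [tssLevyMeasure, integral_withDensity_eq_integral_toReal_smul
    (measurable_tssDensity α σ k t).ennreal_ofReal (by simp)]
  simp only [ENNReal.toReal_ofReal (tssDensity_nonneg h t _)]

lemma integrable_id_tssLevyMeasure (h : IsTSSParameters α σ k) (t : ℝ≥0) :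
    Integrable (fun x => x) (tssLevyMeasure α σ k t) := by
  rw [tssLevyMeasure, integrable_withDensity_iff (measurable_tssDensity α σ k t).ennreal_ofReal
    (by simp)]
  simpa only [ENNReal.toReal_ofReal (tssDensity_nonneg h t _)] using integrable_mul_tssDensity h t

lemma lintegral_min_abs_one_lt_top (h : IsTSSParameters α σ k) (t : ℝ≥0) :
    ∫⁻ x, ENNReal.ofReal (min |x| 1) ∂(tssLevyMeasure α σ k t) < ∞ := by
  refine lt_of_le_of_lt (lintegral_mono fun x => ?_) (integrable_id_tssLevyMeasure h t).2
  rw [← ofReal_norm]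
  exact ENNReal.ofReal_le_ofReal (min_le_left _ _)

lemma isLevyMeasure_tssLevyMeasure (h : IsTSSParameters α σ k) (t : ℝ≥0) :
    IsLevyMeasure (tssLevyMeasure α σ k t) where
  zero := measure_mono_null (by simp) (tssLevyMeasure_Iic α σ k t)
  lintegral_lt_top := by
    refine lt_of_le_of_lt (lintegral_mono fun x => ENNReal.ofReal_le_ofReal ?_)
      (lintegral_min_abs_one_lt_top h t)
    rcases le_total |x| 1 with hx | hx
    · refine le_min ?_ (min_le_right _ _)
      refine (min_le_left _ _).trans ?_
      rw [← sq_abs]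
      nlinarith [abs_nonneg x]
    · exact (min_le_right _ _).trans (le_min hx le_rfl)

/-- Stated for general `s` to serve both $[0,1]$, in the drift, and $[-1,1]$, in the truncation
function. -/
lemma setIntegral_tssLevyMeasure (h : IsTSSParameters α σ k) (t : ℝ≥0) {s : Set ℝ}
    (hs : s ∩ Set.Ioi 0 = Set.Ioc 0 1) :
    ∫ x in s, x ∂(tssLevyMeasure α σ k t) = tssGamma α σ k t := by
  rw [tssLevyMeasure_restrict_eq (u := Set.Ioc 0 1) (by rw [hs]; ext; simp +contextual),
    tssGamma, intervalIntegral.integral_of_le zero_le_one, tssLevyMeasure,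
    setIntegral_withDensity_eq_setIntegral_toReal_smul
      (measurable_tssDensity α σ k t).ennreal_ofReal (by simp) _ measurableSet_Ioc]
  simp only [ENNReal.toReal_ofReal (tssDensity_nonneg h t _), smul_eq_mul, mul_comm]

lemma subordinatorDrift_tss (h : IsTSSParameters α σ k) (t : ℝ≥0) :
    subordinatorDrift (tssLevyMeasure α σ k t) (tssGamma α σ k t) = 0 := by
  rw [subordinatorDrift, setIntegral_tssLevyMeasure h t, sub_self]
  ext x
  simp +contextual [le_of_lt, and_comm]

/-- The Lévy–Khintchine exponent of a tempered stable law, without its drift term. -/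
lemma tss_exponent_eq (h : IsTSSParameters α σ k) (t : ℝ≥0) (u : ℝ) :
    -(((0 : ℝ) * u ^ 2 / 2 : ℝ) : ℂ) + Complex.I * (tssGamma α σ k t : ℂ) * (u : ℂ)
      + ∫ x, (Complex.exp (Complex.I * (u : ℂ) * (x : ℂ)) - 1
          - (Set.Icc (-1 : ℝ) 1).indicator (fun y => Complex.I * (u : ℂ) * (y : ℂ)) x)
            ∂(tssLevyMeasure α σ k t)
      = ∫ x in Set.Ioi (0 : ℝ), (Complex.exp (Complex.I * (u : ℂ) * (x : ℂ)) - 1)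
        ∂(tssLevyMeasure α σ k t) := by
  have hi := integrable_id_tssLevyMeasure h t
  have h1 : Integrable (fun x : ℝ => Complex.exp (Complex.I * (u : ℂ) * (x : ℂ)) - 1)
      (tssLevyMeasure α σ k t) := by
    have := integrable_cexp_sub_one (hi.const_mul u)
    simpa only [Complex.ofReal_mul, ← mul_assoc] using this
  have h2 : Integrable (fun y : ℝ => Complex.I * (u : ℂ) * (y : ℂ)) (tssLevyMeasure α σ k t) :=
    hi.ofReal.const_mul _
  rw [integral_sub h1 (h2.indicator measurableSet_Icc), integral_indicator measurableSet_Icc,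
    integral_const_mul, integral_complex_ofReal, setIntegral_tssLevyMeasure h t,
    tssLevyMeasure_restrict_eq (u := Set.univ) (by simp), Measure.restrict_univ]
  · push_cast
    ring
  · ext x
    simp only [Set.mem_inter_iff, Set.mem_Icc, Set.mem_Ioi, Set.mem_Ioc]
    constructor
    · rintro ⟨⟨-, h1⟩, h2⟩; exact ⟨h2, h1⟩
    · rintro ⟨h1, h2⟩; exact ⟨⟨by linarith, h2⟩, h1⟩

end TemperedStableDensity

/-! ### Construction from a planar Poisson process. -/

section Construction

variable {α : ℝ} {σ k : ℝ≥0 → ℝ}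

/-- The region under the graph of the tempered stable Lévy density at time `t`. -/
def tssRegion (α : ℝ) (σ k : ℝ≥0 → ℝ) (t : ℝ≥0) : Set (ℝ × ℝ) :=
  {p | 0 < p.2 ∧ p.2 ≤ tssDensity α σ k t p.1}

/-- The jump contributed up to time `t` by a point of the plane. -/
noncomputable def tssJump (α : ℝ) (σ k : ℝ≥0 → ℝ) (t : ℝ≥0) : ℝ × ℝ → ℝ :=
  (tssRegion α σ k t).indicator Prod.fst

lemma measurableSet_tssRegion (α : ℝ) (σ k : ℝ≥0 → ℝ) (t : ℝ≥0) :
    MeasurableSet (tssRegion α σ k t) :=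
  (measurableSet_lt measurable_const measurable_snd).inter
    (measurableSet_le measurable_snd ((measurable_tssDensity α σ k t).comp measurable_fst))

lemma measurable_tssJump (α : ℝ) (σ k : ℝ≥0 → ℝ) (t : ℝ≥0) : Measurable (tssJump α σ k t) :=
  measurable_fst.indicator (measurableSet_tssRegion α σ k t)

lemma fst_pos_of_mem_tssRegion {t : ℝ≥0} {p : ℝ × ℝ} (hp : p ∈ tssRegion α σ k t) : 0 < p.1 := by
  by_contra h0
  have := hp.2
  rw [tssDensity_of_nonpos _ _ _ _ (not_lt.1 h0)] at this
  exact this.not_gt hp.1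

lemma tssRegion_mono (h : IsTSSParameters α σ k) : Monotone (tssRegion α σ k) :=
  fun _ _ hst p hp => ⟨hp.1, hp.2.trans (tssDensity_mono h p.1 hst)⟩

lemma tssJump_nonneg (α : ℝ) (σ k : ℝ≥0 → ℝ) (t : ℝ≥0) (p : ℝ × ℝ) : 0 ≤ tssJump α σ k t p :=
  Set.indicator_apply_nonneg fun hp => (fst_pos_of_mem_tssRegion hp).le

lemma tssJump_mono (h : IsTSSParameters α σ k) (p : ℝ × ℝ) :
    Monotone fun t => tssJump α σ k t p := by
  intro s t hst
  by_cases hp : p ∈ tssRegion α σ k s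
  · simp only [tssJump, Set.indicator_of_mem hp,
      Set.indicator_of_mem (tssRegion_mono h hst hp), le_refl]
  · simpa only [tssJump, Set.indicator_of_notMem hp] using tssJump_nonneg α σ k t p

lemma tssJump_zero (α : ℝ) (σ k : ℝ≥0 → ℝ) : tssJump α σ k 0 = 0 := by
  ext p
  refine Set.indicator_of_notMem (fun hp => ?_) _
  have := hp.2
  rw [tssDensity_zero] at this
  exact this.not_gt hp.1

/-- The jump is constant just to the right of $t$: a point under the graph stays there by
monotonicity, and a point strictly above it stays above for a while by continuity in time. -/
lemma continuousWithinAt_tssJump (h : IsTSSParameters α σ k) (p : ℝ × ℝ) (t : ℝ≥0) :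
    ContinuousWithinAt (fun t => tssJump α σ k t p) (Set.Ici t) t := by
  refine (tendsto_const_nhds (x := tssJump α σ k t p)).congr' ?_
  have h1 : ∀ᶠ s in 𝓝[≥] t, (p ∈ tssRegion α σ k t ↔ p ∈ tssRegion α σ k s) := by
    by_cases hp : p ∈ tssRegion α σ k t
    · filter_upwards [self_mem_nhdsWithin] with s hs
      exact iff_of_true hp (tssRegion_mono h hs hp)
    · by_cases hp2 : 0 < p.2
      · have h2 : tssDensity α σ k t p.1 < p.2 := by
          by_contra h3
          exact hp ⟨hp2, not_lt.1 h3⟩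
        have h3 := (continuous_tssDensity h p.1).continuousAt.eventually_lt_const h2
        filter_upwards [nhdsWithin_le_nhds h3] with s hs
        exact iff_of_false hp fun h4 => h4.2.not_gt hs
      · exact Eventually.of_forall fun s => iff_of_false hp fun h4 => hp2 h4.1
  filter_upwards [h1] with s hs
  by_cases hp : p ∈ tssRegion α σ k t
  · simp only [tssJump, Set.indicator_of_mem hp, Set.indicator_of_mem (hs.1 hp)]
  · simp only [tssJump, Set.indicator_of_notMem hp, Set.indicator_of_notMem (hs.not.1 hp)]

/-- By Fubini: the vertical fibre of the region over $x$ has length $\mathcal V_t(x)$. -/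
lemma map_fst_tssRegion (α : ℝ) (σ k : ℝ≥0 → ℝ) (t : ℝ≥0) :
    ((volume : Measure (ℝ × ℝ)).restrict (tssRegion α σ k t)).map Prod.fst
      = tssLevyMeasure α σ k t := by
  ext s hs
  rw [Measure.map_apply measurable_fst hs, Measure.restrict_apply (measurable_fst hs),
    tssLevyMeasure, withDensity_apply _ hs, Measure.volume_eq_prod,
    Measure.prod_apply ((measurable_fst hs).inter (measurableSet_tssRegion α σ k t)),
    ← lintegral_indicator hs]
  congr 1
  ext x
  by_cases hx : x ∈ s
  · have : Prod.mk x ⁻¹' (Prod.fst ⁻¹' s ∩ tssRegion α σ k t)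
        = Set.Ioc 0 (tssDensity α σ k t x) := by
      ext y; simp [tssRegion, hx]
    simp [this, hx]
  · have : Prod.mk x ⁻¹' (Prod.fst ⁻¹' s ∩ tssRegion α σ k t) = ∅ := by
      ext y; simp [hx]
    simp [this, hx]

lemma integrable_tssJump (h : IsTSSParameters α σ k) (t : ℝ≥0) :
    Integrable (tssJump α σ k t) volume := by
  rw [tssJump, integrable_indicator_iff (measurableSet_tssRegion α σ k t), IntegrableOn]
  have h1 := integrable_id_tssLevyMeasure h t
  rw [← map_fst_tssRegion] at h1
  exact h1.comp_measurable measurable_fst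

lemma integral_tssJump (h : IsTSSParameters α σ k) (t : ℝ≥0) :
    ∫ p, tssJump α σ k t p = t * (σ t) ^ 2 := by
  rw [tssJump, integral_indicator (measurableSet_tssRegion α σ k t),
    ← integral_mul_tssDensity h t]
  have h1 := integral_tssLevyMeasure h t fun x => x
  rw [← map_fst_tssRegion, integral_map (f := fun x : ℝ => x)
    measurable_fst.aemeasurable aestronglyMeasurable_id] at h1
  simpa only [smul_eq_mul, mul_comm] using h1

lemma integral_cexp_tssJump (α : ℝ) (σ k : ℝ≥0 → ℝ) (t : ℝ≥0) (u : ℝ) :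
    ∫ p, (Complex.exp (Complex.I * u * (tssJump α σ k t p : ℝ)) - 1)
      = ∫ x in Set.Ioi (0 : ℝ), (Complex.exp (Complex.I * (u : ℂ) * (x : ℂ)) - 1)
        ∂(tssLevyMeasure α σ k t) := by
  rw [tssLevyMeasure_restrict_eq (u := Set.univ) (by simp), Measure.restrict_univ,
    ← map_fst_tssRegion, integral_map measurable_fst.aemeasurable
    (Measurable.aestronglyMeasurable (by fun_prop)),
    ← integral_indicator (measurableSet_tssRegion α σ k t)]
  congr 1
  ext p
  by_cases hp : p ∈ tssRegion α σ k t
  · simp [tssJump, hp]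
  · simp [tssJump, hp]

/-- By monotonicity in time the difference has constant sign, so its $L^1$ norm is the difference of
the means. -/
lemma lintegral_enorm_tssJump_sub (h : IsTSSParameters α σ k) (s t : ℝ≥0) :
    ∫⁻ p, ‖tssJump α σ k s p - tssJump α σ k t p‖ₑ
      = ENNReal.ofReal |(s : ℝ) * (σ s) ^ 2 - t * (σ t) ^ 2| := by
  wlog hst : t ≤ s generalizing s t
  · rw [abs_sub_comm, ← this t s (le_of_not_ge hst)]
    simp only [enorm_sub_rev]
  have h1 : ∀ p, 0 ≤ tssJump α σ k s p - tssJump α σ k t p := fun p =>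
    sub_nonneg.2 (tssJump_mono h p hst)
  have h2 : 0 ≤ (s : ℝ) * (σ s) ^ 2 - t * (σ t) ^ 2 := by
    rw [← integral_tssJump h, ← integral_tssJump h,
      ← integral_sub (integrable_tssJump h s) (integrable_tssJump h t)]
    exact integral_nonneg h1
  rw [abs_of_nonneg h2, ← integral_tssJump h, ← integral_tssJump h,
    ← integral_sub (integrable_tssJump h s) (integrable_tssJump h t),
    ofReal_integral_eq_lintegral_ofReal
      (f := fun p => tssJump α σ k s p - tssJump α σ k t p)
      ((integrable_tssJump h s).sub (integrable_tssJump h t)) (ae_of_all _ h1)]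
  congr 1
  ext p
  rw [Real.enorm_of_nonneg (h1 p)]

lemma blockSum_tssJump_mono (h : IsTSSParameters α σ k) (q : ℕ × (ℕ → ℝ × ℝ)) :
    Monotone fun t => blockSum (tssJump α σ k t) q :=
  fun _ _ hst => Finset.sum_le_sum fun _ _ => tssJump_mono h _ hst

lemma blockSum_tssJump_nonneg (α : ℝ) (σ k : ℝ≥0 → ℝ) (t : ℝ≥0) (q : ℕ × (ℕ → ℝ × ℝ)) :
    0 ≤ blockSum (tssJump α σ k t) q :=
  Finset.sum_nonneg fun _ _ => tssJump_nonneg α σ k t _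

/-- Configurations whose jumps are summable up to any time. -/
def tssGood (α : ℝ) (σ k : ℝ≥0 → ℝ) : Set (ℕ → ℕ × (ℕ → ℝ × ℝ)) :=
  {ω | ∀ t : ℝ≥0, Summable fun n => blockSum (tssJump α σ k t) (ω n)}

lemma mem_tssGood_of_natCast (h : IsTSSParameters α σ k) {ω : ℕ → ℕ × (ℕ → ℝ × ℝ)}
    (hω : ∀ m : ℕ, Summable fun n => blockSum (tssJump α σ k m) (ω n)) :
    ω ∈ tssGood α σ k := by
  intro t
  obtain ⟨m, hm⟩ := exists_nat_ge t
  exact Summable.of_nonneg_of_le (fun n => blockSum_tssJump_nonneg α σ k t _)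
    (fun n => blockSum_tssJump_mono h _ hm) (hω m)

lemma poissonSum_tssJump_mono (h : IsTSSParameters α σ k) {ω : ℕ → ℕ × (ℕ → ℝ × ℝ)}
    (hω : ω ∈ tssGood α σ k) : Monotone fun t => poissonSum (tssJump α σ k t) ω :=
  fun s t hst => Summable.tsum_le_tsum (fun _ => blockSum_tssJump_mono h _ hst) (hω s) (hω t)

lemma continuousWithinAt_poissonSum_tssJump (h : IsTSSParameters α σ k)
    {ω : ℕ → ℕ × (ℕ → ℝ × ℝ)} (hω : ω ∈ tssGood α σ k) (t : ℝ≥0) :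
    ContinuousWithinAt (fun t => poissonSum (tssJump α σ k t) ω) (Set.Ici t) t := by
  -- For times up to $t+1$ every block sum is dominated by its value at $t+1$.
  refine tendsto_tsum_of_dominated_convergence (hω (t + 1)) (fun n => ?_) ?_
  · exact tendsto_finsetSum _ fun i _ => continuousWithinAt_tssJump h _ t
  · have h1 : ∀ᶠ s in 𝓝 t, s ≤ t + 1 := eventually_le_nhds (lt_add_one t)
    filter_upwards [nhdsWithin_le_nhds h1] with s hs n
    rw [Real.norm_of_nonneg (blockSum_tssJump_nonneg α σ k s _)]
    exact blockSum_tssJump_mono h _ hs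

lemma poissonSum_tssJump_sub {ω : ℕ → ℕ × (ℕ → ℝ × ℝ)} (hω : ω ∈ tssGood α σ k) (s t : ℝ≥0) :
    poissonSum (fun p => tssJump α σ k s p - tssJump α σ k t p) ω
      = poissonSum (tssJump α σ k s) ω - poissonSum (tssJump α σ k t) ω := by
  simp only [poissonSum]
  rw [← (hω s).tsum_sub (hω t)]
  simp only [blockSum, Finset.sum_sub_distrib]

lemma isCadlagPath_of_monotone {f : ℝ≥0 → ℝ} (hf : Monotone f)
    (hc : ∀ t, ContinuousWithinAt f (Set.Ici t) t) : IsCadlagPath f :=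
  ⟨hc, fun t _ => ⟨_, hf.tendsto_nhdsLT t⟩⟩

/-- The additive tempered stable subordinator: the sum of the jumps of a planar Poisson process
lying under the graph of the Lévy density, set to zero on an exceptional null set `B`. -/
noncomputable def tssProcess (α : ℝ) (σ k : ℝ≥0 → ℝ) (B : Set (ℕ → ℕ × (ℕ → ℝ × ℝ))) (t : ℝ≥0) :
    (ℕ → ℕ × (ℕ → ℝ × ℝ)) → ℝ :=
  Bᶜ.indicator (poissonSum (tssJump α σ k t))

lemma monotone_tssProcess (h : IsTSSParameters α σ k) {B : Set (ℕ → ℕ × (ℕ → ℝ × ℝ))}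
    (hB : Bᶜ ⊆ tssGood α σ k) (ω : ℕ → ℕ × (ℕ → ℝ × ℝ)) :
    Monotone fun t => tssProcess α σ k B t ω := by
  by_cases hω : ω ∈ Bᶜ
  · simpa only [tssProcess, Set.indicator_of_mem hω] using poissonSum_tssJump_mono h (hB hω)
  · simpa only [tssProcess, Set.indicator_of_notMem hω] using monotone_const

lemma isCadlagPath_tssProcess (h : IsTSSParameters α σ k) {B : Set (ℕ → ℕ × (ℕ → ℝ × ℝ))}
    (hB : Bᶜ ⊆ tssGood α σ k) (ω : ℕ → ℕ × (ℕ → ℝ × ℝ)) :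
    IsCadlagPath fun t => tssProcess α σ k B t ω := by
  refine isCadlagPath_of_monotone (monotone_tssProcess h hB ω) fun t => ?_
  by_cases hω : ω ∈ Bᶜ
  · simpa only [tssProcess, Set.indicator_of_mem hω]
      using continuousWithinAt_poissonSum_tssJump h (hB hω) t
  · simpa only [tssProcess, Set.indicator_of_notMem hω] using continuousWithinAt_const

section Law

variable {r : ℕ → ℝ≥0} {ρ : ℕ → Measure (ℝ × ℝ)} [∀ n, IsProbabilityMeasure (ρ n)]

lemma ae_mem_tssGood (h : IsTSSParameters α σ k) (hρ : poissonIntensity r ρ = volume) :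
    ∀ᵐ ω ∂(poissonSpace r ρ), ω ∈ tssGood α σ k := by
  have h1 : ∀ m : ℕ, ∀ᵐ ω ∂(poissonSpace r ρ),
      Summable fun n => blockSum (tssJump α σ k m) (ω n) := fun m =>
    ae_summable_blockSum r ρ (measurable_tssJump α σ k m) (hρ ▸ integrable_tssJump h m)
  filter_upwards [ae_all_iff.2 h1] with ω hω using mem_tssGood_of_natCast h hω

/-- The $i$-th increment only sees points in the layer between the regions at consecutive times, and
distinct layers are disjoint. -/
lemma hasIndepIncrements_poissonSum_tssJump (h : IsTSSParameters α σ k)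
    (hρ : poissonIntensity r ρ = volume) :
    HasIndepIncrements (fun t => poissonSum (tssJump α σ k t)) (poissonSpace r ρ) := by
  intro n τ hτ
  have h1 : iIndepFun (fun i : Fin n => poissonSum fun p =>
      tssJump α σ k (τ i.succ) p - tssJump α σ k (τ i.castSucc) p) (poissonSpace r ρ) := by
    refine iIndepFun_poissonSum r ρ
      (fun i => (measurable_tssJump α σ k _).sub (measurable_tssJump α σ k _))
      (fun i => hρ ▸ (integrable_tssJump h _).sub (integrable_tssJump h _)) ?_
    have h2 : ∀ (p : ℝ × ℝ) (i : Fin n),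
        tssJump α σ k (τ i.succ) p - tssJump α σ k (τ i.castSucc) p ≠ 0 →
        p ∈ tssRegion α σ k (τ i.succ) ∧ p ∉ tssRegion α σ k (τ i.castSucc) := by
      intro p i hp
      have h4 : p ∉ tssRegion α σ k (τ i.castSucc) := fun h4 => by
        have h3 := tssRegion_mono h (hτ i.castSucc_le_succ) h4
        simp [tssJump, h3, h4] at hp
      refine ⟨?_, h4⟩
      by_contra h3
      simp [tssJump, h3, h4] at hp
    have h5 : ∀ (p : ℝ × ℝ) (i j : Fin n), i < j →
        p ∈ tssRegion α σ k (τ i.succ) → p ∈ tssRegion α σ k (τ j.castSucc) := fun p i j hij =>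
      fun hp => tssRegion_mono h (hτ (Fin.succ_le_castSucc_iff.2 hij)) hp
    intro p i j hi hj
    by_contra hne
    rcases lt_or_gt_of_ne hne with hij | hij
    · exact (h2 p j hj).2 (h5 p i j hij (h2 p i hi).1)
    · exact (h2 p i hi).2 (h5 p j i hij (h2 p j hj).1)
  refine h1.congr fun i => ?_
  filter_upwards [ae_mem_tssGood h hρ] with ω hω using poissonSum_tssJump_sub hω _ _

lemma tendstoInMeasure_poissonSum_tssJump (h : IsTSSParameters α σ k)
    (hρ : poissonIntensity r ρ = volume) (t : ℝ≥0) :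
    TendstoInMeasure (poissonSpace r ρ) (fun t => poissonSum (tssJump α σ k t)) (𝓝 t)
      (poissonSum (tssJump α σ k t)) := by
  refine tendstoInMeasure_of_tendsto_eLpNorm one_ne_zero
    (fun s => (measurable_poissonSum (measurable_tssJump α σ k s)).aestronglyMeasurable)
    (measurable_poissonSum (measurable_tssJump α σ k t)).aestronglyMeasurable ?_
  have h1 : Tendsto (fun s : ℝ≥0 => ENNReal.ofReal |(s : ℝ) * (σ s) ^ 2 - t * (σ t) ^ 2|)
      (𝓝 t) (𝓝 0) := by
    have h2 : Continuous fun s : ℝ≥0 =>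
        ENNReal.ofReal |(s : ℝ) * (σ s) ^ 2 - t * (σ t) ^ 2| :=
      ENNReal.continuous_ofReal.comp ((continuous_tssMean h).sub continuous_const).abs
    simpa using h2.tendsto t
  refine tendsto_of_tendsto_of_tendsto_of_le_of_le tendsto_const_nhds h1 (fun _ => zero_le)
    fun s => ?_
  rw [eLpNorm_one_eq_lintegral_enorm, ← lintegral_enorm_tssJump_sub h, ← hρ]
  refine le_trans (le_of_eq (lintegral_congr_ae ?_)) (lintegral_enorm_poissonSum_le r ρ
    ((measurable_tssJump α σ k s).sub (measurable_tssJump α σ k t)))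
  filter_upwards [ae_mem_tssGood h hρ] with ω hω
  rw [poissonSum_tssJump_sub hω]
  rfl

end Law

/-- An additive tempered stable subordinator with non-decreasing paths exists. -/
lemma exists_isTSS_monotone (h : IsTSSParameters α σ k) :
    ∃ (Ω : Type) (_ : MeasurableSpace Ω) (P : Measure Ω) (_ : IsProbabilityMeasure P)
      (Z : ℝ≥0 → Ω → ℝ), IsTSS α σ k Z P ∧ ∀ ω, Monotone fun t => Z t ω := by
  obtain ⟨r, ρ, hp, hρ⟩ := exists_poissonIntensity_eq (volume : Measure (ℝ × ℝ))
  set P := poissonSpace r ρ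
  -- A measurable null hull of the bad configurations keeps $Z_t$ measurable, while zeroing on it
  -- makes every path, not just almost every one, càdlàg.
  set B := toMeasurable P (tssGood α σ k)ᶜ
  have hB : Bᶜ ⊆ tssGood α σ k := Set.compl_subset_comm.1 (subset_toMeasurable _ _)
  have hPB : P B = 0 := (measure_toMeasurable _).trans (ae_mem_tssGood h hρ)
  have hae : ∀ t, tssProcess α σ k B t =ᵐ[P] poissonSum (tssJump α σ k t) := fun t => by
    filter_upwards [measure_eq_zero_iff_ae_notMem.1 hPB] with ω hω
    exact Set.indicator_of_mem hω _
  refine ⟨_, _, P, inferInstance, tssProcess α σ k B, ⟨⟨fun t => ?_,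
    isCadlagPath_tssProcess h hB, ?_, ?_, fun t => ?_⟩, fun t => ?_⟩, monotone_tssProcess h hB⟩
  · exact (measurable_poissonSum (measurable_tssJump α σ k t)).indicator
      (measurableSet_toMeasurable _ _).compl
  · filter_upwards [hae 0] with ω hω
    rw [hω, tssJump_zero]
    simp [poissonSum, blockSum]
  · intro n τ hτ
    refine (hasIndepIncrements_poissonSum_tssJump h hρ n τ hτ).congr fun i => ?_
    filter_upwards [hae (τ i.succ), hae (τ i.castSucc)] with ω h1 h2
    rw [h1, h2]
  · exact (tendstoInMeasure_poissonSum_tssJump h hρ t).congr (fun s => (hae s).symm) (hae t).symm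
  · refine ⟨le_rfl, isLevyMeasure_tssLevyMeasure h t, fun u => ?_⟩
    rw [tss_exponent_eq h, Measure.map_congr (hae t), charFun_map_poissonSum r ρ
      (measurable_tssJump α σ k t) (hρ ▸ integrable_tssJump h t), hρ, integral_cexp_tssJump]

end Construction

/-! ### Laws of increments and monotone paths for an arbitrary TSS. -/

section Uniqueness

variable {α : ℝ} {σ k : ℝ≥0 → ℝ} {Ω : Type*} [MeasurableSpace Ω] {P : Measure Ω}
  {Ω' : Type*} [MeasurableSpace Ω'] {P' : Measure Ω'}

lemma IsAdditiveProcess.charFun_mul [IsProbabilityMeasure P] {X : ℝ≥0 → Ω → ℝ} (hX : IsAdditiveProcess X P)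
    {s t : ℝ≥0} (hst : s ≤ t) (u : ℝ) :
    charFun (P.map (X t)) u = charFun (P.map (X s)) u * charFun (P.map (X t - X s)) u := by
  -- As $X_0=0$ almost surely, $X_s$ is itself an increment, independent of $X_t-X_s$.
  have h1 := hX.indepIncrements.indepFun_eval_sub zero_le hst hX.zero_ae
  have h2 := h1.charFun_map_add_eq_mul (hX.measurable s).aemeasurable
    ((hX.measurable t).sub (hX.measurable s)).aemeasurable
  rw [← Pi.mul_apply, ← h2, add_sub_cancel]

/-- The triplets of an additive tempered stable subordinator determine the laws of its
increments. -/
lemma IsTSS.map_sub_eq [IsProbabilityMeasure P] [IsProbabilityMeasure P'] {Z : ℝ≥0 → Ω → ℝ}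
    {Z' : ℝ≥0 → Ω' → ℝ} (hZ : IsTSS α σ k Z P) (hZ' : IsTSS α σ k Z' P') {s t : ℝ≥0}
    (hst : s ≤ t) : P.map (Z t - Z s) = P'.map (Z' t - Z' s) := by
  have := Measure.isProbabilityMeasure_map (μ := P)
    ((hZ.additive.measurable t).sub (hZ.additive.measurable s)).aemeasurable
  have := Measure.isProbabilityMeasure_map (μ := P')
    ((hZ'.additive.measurable t).sub (hZ'.additive.measurable s)).aemeasurable
  refine Measure.ext_of_charFun (funext fun u => ?_)
  have h1 := hZ.additive.charFun_mul hst u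
  have h2 := hZ'.additive.charFun_mul hst u
  rw [(hZ.triplet t).charFun_eq, (hZ.triplet s).charFun_eq] at h1
  rw [(hZ'.triplet t).charFun_eq, (hZ'.triplet s).charFun_eq, h1] at h2
  exact mul_left_cancel₀ (Complex.exp_ne_zero _) h2

/-- Non-negativity of the increment depends only on its law, so it transfers from the monotone
model. -/
lemma IsTSS.ae_le [IsProbabilityMeasure P] {Z : ℝ≥0 → Ω → ℝ} (h : IsTSSParameters α σ k)
    (hZ : IsTSS α σ k Z P) {s t : ℝ≥0} (hst : s ≤ t) : ∀ᵐ ω ∂P, Z s ω ≤ Z t ω := by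
  obtain ⟨Ω', _, P', _, Z', hZ', hm⟩ := exists_isTSS_monotone h
  have h1 : ∀ᵐ x ∂(P'.map (Z' t - Z' s)), 0 ≤ x :=
    (ae_map_iff ((hZ'.additive.measurable t).sub (hZ'.additive.measurable s)).aemeasurable
      measurableSet_Ici).2 (ae_of_all _ fun ω => sub_nonneg.2 (hm ω hst))
  rw [← hZ.map_sub_eq hZ' hst] at h1
  have h2 := ae_of_ae_map
    ((hZ.additive.measurable t).sub (hZ.additive.measurable s)).aemeasurable h1
  filter_upwards [h2] with ω hω using sub_nonneg.1 hω

/-- If $f(t)<c<f(s)$ with $s<t$, right-continuity gives points $p<t<q$ of the dense set, just right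
of $s$ and of $t$, with $f(q)<c<f(p)$. -/
lemma monotone_of_monotoneOn_dense {f : ℝ≥0 → ℝ} (hf : ∀ t, ContinuousWithinAt f (Set.Ici t) t)
    {D : Set ℝ≥0} (hD : Dense D) (hm : MonotoneOn f D) : Monotone f := by
  intro s t hst
  rcases hst.eq_or_lt with rfl | hst
  · exact le_rfl
  by_contra hlt
  obtain ⟨c, hc1, hc2⟩ := exists_between (not_le.1 hlt)
  have h1 : ∀ᶠ q in 𝓝[>] s, c < f q :=
    ((hf s).mono Set.Ioi_subset_Ici_self).eventually_const_lt hc2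
  have h2 : ∀ᶠ q in 𝓝[>] t, f q < c :=
    ((hf t).mono Set.Ioi_subset_Ici_self).eventually_lt_const hc1
  obtain ⟨b, hb, hb'⟩ := (mem_nhdsGT_iff_exists_Ioo_subset' hst).1 h1
  obtain ⟨d, hd, hd'⟩ := (mem_nhdsGT_iff_exists_Ioo_subset' (lt_add_one t)).1 h2
  obtain ⟨p, hpD, hp⟩ := hD.exists_between (lt_min hb hst)
  obtain ⟨q, hqD, hq⟩ := hD.exists_between hd
  have h3 : c < f p := hb' ⟨hp.1, hp.2.trans_le (min_le_left _ _)⟩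
  have h4 : f q < c := hd' hq
  have h5 := hm hpD hqD ((hp.2.trans_le (min_le_right _ _)).trans hq.1).le
  linarith

lemma IsTSS.isAdditiveSubordinator [IsProbabilityMeasure P] {Z : ℝ≥0 → Ω → ℝ}
    (h : IsTSSParameters α σ k) (hZ : IsTSS α σ k Z P) : IsAdditiveSubordinator Z P where
  additive := hZ.additive
  monotone_ae := by
    obtain ⟨D, hDc, hD⟩ := TopologicalSpace.exists_countable_dense ℝ≥0
    have h1 : ∀ᵐ ω ∂P, ∀ s ∈ D, ∀ t ∈ D, s ≤ t → Z s ω ≤ Z t ω := by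
      refine (ae_ball_iff hDc).2 fun s _ => (ae_ball_iff hDc).2 fun t _ => ?_
      by_cases hst : s ≤ t
      · filter_upwards [hZ.ae_le h hst] with ω hω _ using hω
      · exact ae_of_all _ fun ω h2 => absurd h2 hst
    filter_upwards [h1] with ω hω
    exact monotone_of_monotoneOn_dense (hZ.additive.cadlag ω).1 hD
      fun s hs t ht hst => hω s hs t ht hst

end Uniqueness

theorem mainTheorem5 (α : ℝ) (σ k : ℝ≥0 → ℝ) (h : IsTSSParameters α σ k) :
    (∃ (Ω : Type) (_ : MeasurableSpace Ω) (P : Measure Ω) (_ : IsProbabilityMeasure P)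
      (Z : ℝ≥0 → Ω → ℝ), IsTSS α σ k Z P) ∧
    (∀ (Ω : Type*) [MeasurableSpace Ω] (P : Measure Ω) [IsProbabilityMeasure P]
      (Z : ℝ≥0 → Ω → ℝ), IsTSS α σ k Z P →
        IsAdditiveSubordinator Z P ∧
        ∀ (t : ℝ≥0) (u : ℝ), charFun (P.map (Z t)) u =
          Complex.exp (∫ x in Set.Ioi (0 : ℝ),
            (Complex.exp (Complex.I * (u : ℂ) * (x : ℂ)) - 1) ∂(tssLevyMeasure α σ k t))) ∧
    (∀ t : ℝ≥0,
      tssLevyMeasure α σ k t (Set.Iic 0) = 0 ∧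
      (∫⁻ x, ENNReal.ofReal (min |x| 1) ∂(tssLevyMeasure α σ k t)) < ∞ ∧
      subordinatorDrift (tssLevyMeasure α σ k t) (tssGamma α σ k t) = 0) := by
  refine ⟨?_, fun Ω _ P _ Z hZ => ⟨hZ.isAdditiveSubordinator h, fun t u => ?_⟩, fun t =>
    ⟨tssLevyMeasure_Iic α σ k t, lintegral_min_abs_one_lt_top h t, subordinatorDrift_tss h t⟩⟩
  · obtain ⟨Ω, m, P, hP, Z, hZ, -⟩ := exists_isTSS_monotone h
    exact ⟨Ω, m, P, hP, Z, hZ⟩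
  · rw [(hZ.triplet t).charFun_eq, tss_exponent_eq h]
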